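/- Let $k\ge 0$ be an integer and let $0<\gamma_{\min}\le\gamma_{\max}$. There is a constant $K>0$, depending only on $k,\gamma_{\min},\gamma_{\max}$, such that the following holds for every $n\ge 1$, every positive definite $Q\in\mathbb{R}^{n\times n}$ with bandwidth $k$ (that is, $Q_{ij}=0$ if $|i-j|>k$) and with smallest and largest eigenvalues $\gamma_{\min}$ and $\gamma_{\max}$, every $\epsilon>0$ and every $\ell\in\{0,\dots,n\}$. Put $\kappa=\gamma_{\max}/\gamma_{\min}$, $\gamma=\frac{\sqrt{\kappa}-1}{\sqrt{\kappa}+1}\in[0,1)$ (if $\gamma=0$, then $1/|\log\gamma|$ is read as $0$) and $\pi_j=\max\{i: Q_{ji}\neq 0\}$. The compressed decision diagram of $Q$ has layers $1,\dots,n+1$; its nodes are $n\times n$ matrices (states). The root, in layer $1$, is the zero matrix. Assigning the value $\nu\in\{0,1\}$ to the variable $z_p$ leads from a state $W$ in layer $p$ to the state $W'$ in layer $p+1$ given by $W'_{ij}=0$ if $\pi_j\le p$ and $W'_{ij}=W_{ij}+\nu u_iu_j$ otherwise, where $u=\bigl(-WQ_p+e_p\bigr)/\sqrt{Q_{pp}-Q_p^\top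 WQ_p}$ and $Q_p$ is the $p$-th column of $Q$. Paths that reach equal states in the same layer share the node. Two states $W,W'$ in layer $L$ are $\epsilon$-indistinguishable if $\|W_j-W'_j\|_\infty\le\epsilon$ for all columns $j$ with $j\le L\le\pi_j$. (i) Let $m\ge 0$ be an integer with $m\ge k-1+k\,\frac{\log(K/\epsilon)}{|\log\gamma|}$, and let $\bar z,\hat z\in\{0,1\}^\ell$ satisfy $\hat z_i=0$ for all $i\le\ell-m$ and $\bar z_i=\hat z_i$ for all $i>\ell-m$. Then the two paths from the root with assignments $\bar z$ and $\hat z$ lead to $\epsilon$-indistinguishable states in layer $\ell+1$. (ii) Completely merge the $\epsilon$-indistinguishable states of layer $\ell+1$ of this diagram: repeatedly replace two distinct $\epsilon$-indistinguishable nodes by one of them, in any order and with any choice of the representative, until no two distinct remaining nodes are $\epsilon$-indistinguishable. Then at most $$2^k\,\max\{1,K/\epsilon\}^{k/|\log\gamma|}$$ nodes remain, a bound that is independent of the layer and of $n$. In particular, for $\epsilon\le K$ at most $2^k(K/\epsilon)^{k/|\log\gamma|}$ nodes remain. -/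

import Mathlib

noncomputable section

namespace BandedDD

variable {n : ℕ}

/-- `Q` has bandwidth `k`: `Q i j = 0` whenever `|i - j| > k`. -/
def HasBandwidth (Q : Matrix (Fin n) (Fin n) ℝ) (k : ℕ) : Prop :=
  ∀ i j : Fin n, (k : ℤ) < |(i : ℤ) - (j : ℤ)| → Q i j = 0

/-- The smallest eigenvalue of a symmetric matrix. -/
def minEig (Q : Matrix (Fin n) (Fin n) ℝ) : ℝ := sInf (spectrum ℝ Q)

/-- The largest eigenvalue of a symmetric matrix. -/
def maxEig (Q : Matrix (Fin n) (Fin n) ℝ) : ℝ := sSup (spectrum ℝ Q)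

/-- The condition number of a positive definite matrix. -/
def condNumber (Q : Matrix (Fin n) (Fin n) ℝ) : ℝ := maxEig Q / minEig Q

/-- The decay rate `γ = (√cond - 1) / (√cond + 1)`, an element of `[0, 1)`. -/
def decayRate (Q : Matrix (Fin n) (Fin n) ℝ) : ℝ :=
  (Real.sqrt (condNumber Q) - 1) / (Real.sqrt (condNumber Q) + 1)

open Classical in
/-- The relevant index `π_i = max {j : Q i j ≠ 0}`, as a number in `{1, ..., n}`: the element
`j : Fin n` carries the number `j + 1`. (The set is nonempty when `Q` is positive definite.) -/
def relevantIndex (Q : Matrix (Fin n) (Fin n) ℝ) (i : Fin n) : ℕ :=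
  (Finset.univ.filter fun j : Fin n => Q i j ≠ 0).sup fun j => (j : ℕ) + 1

/-- The transition vector `u = (-W Q_ℓ + e_ℓ) / √(Q_ℓℓ - Q_ℓᵀ W Q_ℓ)`, where `Q_ℓ` is the
`ℓ`-th column of `Q`. -/
def transitionVec (Q : Matrix (Fin n) (Fin n) ℝ) (ℓ : Fin n) (W : Matrix (Fin n) (Fin n) ℝ) :
    Fin n → ℝ :=
  (1 / Real.sqrt (Q ℓ ℓ - Q.col ℓ ⬝ᵥ W.mulVec (Q.col ℓ))) •
    (-(W.mulVec (Q.col ℓ)) + Pi.single ℓ 1)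

/-- The transition function of the compressed diagram: assigning the value `v` to variable `ℓ`
(which has number `ℓ + 1`) in state `W`. Columns that are no longer relevant are set to zero. -/
def transition (Q : Matrix (Fin n) (Fin n) ℝ) (ℓ : Fin n) (W : Matrix (Fin n) (Fin n) ℝ)
    (v : Bool) : Matrix (Fin n) (Fin n) ℝ :=
  Matrix.of fun i j =>
    if relevantIndex Q j ≤ (ℓ : ℕ) + 1 then 0
    else if v then W i j + transitionVec Q ℓ W i * transitionVec Q ℓ W j
    else W i j

/-- The state reached from the root (the zero matrix) by the path that makes the first `ℓ`
assignments of `z`. It lies in the layer with number `ℓ + 1`. -/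
def pathState (Q : Matrix (Fin n) (Fin n) ℝ) (z : Fin n → Bool) (ℓ : Fin (n + 1)) :
    Matrix (Fin n) (Fin n) ℝ :=
  Fin.induction (motive := fun _ => Matrix (Fin n) (Fin n) ℝ) 0
    (fun i W => transition Q i W (z i)) ℓ

/-- The nodes of the compressed diagram in the layer with number `ℓ + 1`, that is, the states
reached by the paths of `ℓ` arcs from the root. Paths reaching equal states share a node. -/
def layer (Q : Matrix (Fin n) (Fin n) ℝ) (ℓ : Fin (n + 1)) : Set (Matrix (Fin n) (Fin n) ℝ) :=
  Set.range fun z : Fin n → Bool => pathState Q z ℓ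

/-- Two states in the layer with number `L = ℓ + 1` are `ε`-indistinguishable: all columns with
number `j` such that `j ≤ L ≤ π_j` differ by at most `ε` in the maximum norm
(the norm of `Fin n → ℝ`). -/
def Indistinguishable (Q : Matrix (Fin n) (Fin n) ℝ) (ε : ℝ) (ℓ : Fin (n + 1))
    (W W' : Matrix (Fin n) (Fin n) ℝ) : Prop :=
  ∀ j : Fin n, (j : ℕ) + 1 ≤ (ℓ : ℕ) + 1 → (ℓ : ℕ) + 1 ≤ relevantIndex Q j →
    ‖W.col j - W'.col j‖ ≤ ε

/-- One merge in a set `N` of nodes: two distinct `ε`-indistinguishable nodes `s`, `t` are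
replaced by one of the two, here called `s`. -/
def MergeStep (Q : Matrix (Fin n) (Fin n) ℝ) (ε : ℝ) (ℓ : Fin (n + 1))
    (N N' : Set (Matrix (Fin n) (Fin n) ℝ)) : Prop :=
  ∃ s ∈ N, ∃ t ∈ N, s ≠ t ∧ Indistinguishable Q ε ℓ s t ∧ N' = N \ {t}

/-- `R` is left by a complete merging of the layer with number `ℓ + 1`: it is obtained from the
layer by successive merges, in any order and with any choice of representatives, and no two
distinct nodes of `R` can be merged any more. -/
def IsCompleteMerging (Q : Matrix (Fin n) (Fin n) ℝ) (ε : ℝ) (ℓ : Fin (n + 1))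
    (R : Set (Matrix (Fin n) (Fin n) ℝ)) : Prop :=
  Relation.ReflTransGen (MergeStep Q ε ℓ) (layer Q ℓ) R ∧
    ∀ s ∈ R, ∀ t ∈ R, Indistinguishable Q ε ℓ s t → s = t

end BandedDD

end

/-!
A path of the decision diagram chooses a set `S` of indices. Without the compression its state is
the inverse of the principal submatrix of `Q` on `S`, extended by zero
(`isPrincipalInverse_fullState`); the compression only deletes columns that no later transition
reads (`pathState_apply`). For a layer with `ℓ` assignments made, only the columns `j` with
`ℓ ≤ j + k` (indices counted from `0`) are compared.

Two choices `S`, `S'` that agree on the last `m` assignments give nearby columns `j`. Complete the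
submatrices to matrices `A`, `A'` on all indices by the diagonal entry `a`, the smallest eigenvalue
of `Q`; this keeps the spectrum in `[a, b]`, where `b` is the largest eigenvalue
(`spectrum_paddedSubmatrix`). A scaled Chebyshev polynomial gives a polynomial `p` of degree less
than `m / k` (division of natural numbers) that approximates `x⁻¹` on `[a, b]` up to
`2 / a * γ ^ (m / k)` (`exists_polynomial_approx_inv`), so `p A` and `p A'` approximate the two
inverses entrywise with this error. Since `A` and `A'` have bandwidth `k`, the column `j` of a power
`t < m / k` does not see the indices before `ℓ - m` (`pow_paddedSubmatrix_congr`), and the columns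
`j` of `p A` and `p A'` coincide. Hence the two states differ by at most `4 / a * γ ^ (m / k)`
(`abs_fullState_sub_le`), and `K = 4 / a` serves for the first claim. If `γ = 0`, then `Q` is a
multiple of the identity and the states have no nonzero column that is compared.

This estimate compares any two paths with the same last `m` assignments, not only a path and its
truncation. The nodes that remain after complete merging are therefore determined by their last `m`
assignments (`IsCompleteMerging.ncard_le`), where `m` is the least natural number that satisfies the
condition with `max 1 (K / ε)` in place of `K / ε`; rounding up and `log 2 ≤ 1` turn `2 ^ m` into
the stated bound (`two_pow_ceil_le`).
-/

namespace BandedDD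

variable {n : ℕ}

/-! ### Entrywise functional calculus -/

section FunctionalCalculus

open Polynomial
open scoped MatrixOrder Matrix.Norms.L2Operator

lemma abs_entry_le_l2_opNorm (B : Matrix (Fin n) (Fin n) ℝ) (i j : Fin n) : |B i j| ≤ ‖B‖ := by
  have h := Matrix.l2_opNorm_mulVec B (EuclideanSpace.single j (1 : ℝ))
  have h2 := PiLp.norm_apply_le
    ((EuclideanSpace.equiv (Fin n) ℝ).symm (B.mulVec (EuclideanSpace.single j (1 : ℝ)).ofLp)) i
  have h3 := h2.trans h
  simpa using h3

lemma abs_cfc_entry_le {A : Matrix (Fin n) (Fin n) ℝ} {f : ℝ → ℝ} {M : ℝ}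
    (hM : 0 ≤ M) (h : ∀ x ∈ spectrum ℝ A, |f x| ≤ M) (i j : Fin n) : |cfc f A i j| ≤ M :=
  (abs_entry_le_l2_opNorm _ i j).trans (norm_cfc_le hM h)

/-- An approximation of `x ↦ x⁻¹` by a polynomial on the spectrum of `A` yields an approximation of
the inverse of `A` by the same polynomial in `A`, with the same error in every entry. -/
lemma abs_inv_sub_aeval_entry_le {A X : Matrix (Fin n) (Fin n) ℝ} (hA : A.IsHermitian)
    (hAX : A * X = 1) {p : ℝ[X]} {M : ℝ} (hM : 0 ≤ M)
    (h0 : ∀ x ∈ spectrum ℝ A, x ≠ 0) (h : ∀ x ∈ spectrum ℝ A, |x⁻¹ - p.eval x| ≤ M)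
    (i j : Fin n) : |X i j - aeval A p i j| ≤ M := by
  have hsa : IsSelfAdjoint A := hA
  have hc : ContinuousOn (fun x : ℝ => x⁻¹) (spectrum ℝ A) :=
    continuousOn_id.inv₀ h0
  have hmul : A * cfc (fun x : ℝ => x⁻¹) A = 1 := by
    nth_rewrite 1 [← cfc_id' ℝ A]
    rw [← cfc_mul (fun x : ℝ => x) (fun x : ℝ => x⁻¹) A continuousOn_id hc, ← cfc_one ℝ A]
    exact cfc_congr fun x hx => mul_inv_cancel₀ (h0 x hx)
  have hX : X = cfc (fun x : ℝ => x⁻¹) A := by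
    rw [← Matrix.inv_eq_right_inv hAX, Matrix.inv_eq_right_inv hmul]
  have key : X - aeval A p = cfc (fun x : ℝ => x⁻¹ - p.eval x) A := by
    rw [cfc_sub (fun x : ℝ => x⁻¹) (fun x => p.eval x) A hc p.continuous.continuousOn,
      cfc_polynomial p A, hX]
  rw [← Matrix.sub_apply, key]
  exact abs_cfc_entry_le hM h i j

lemma forall_le_spectrum_iff {A : Matrix (Fin n) (Fin n) ℝ} (hA : A.IsHermitian) (a : ℝ) :
    (∀ x ∈ spectrum ℝ A, a ≤ x) ↔ (A - algebraMap ℝ _ a).PosSemidef := by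
  have : IsSelfAdjoint A := hA
  rw [← Matrix.le_iff, algebraMap_le_iff_le_spectrum]

lemma forall_spectrum_le_iff {A : Matrix (Fin n) (Fin n) ℝ} (hA : A.IsHermitian) (b : ℝ) :
    (∀ x ∈ spectrum ℝ A, x ≤ b) ↔ (algebraMap ℝ _ b - A).PosSemidef := by
  have : IsSelfAdjoint A := hA
  rw [← Matrix.le_iff, le_algebraMap_iff_spectrum_le]

/-- A symmetric matrix whose only eigenvalue is `a` has no nonzero off-diagonal entry. -/
lemma apply_eq_zero_of_spectrum_eq {A : Matrix (Fin n) (Fin n) ℝ} (hA : A.IsHermitian) {a : ℝ}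
    (h : ∀ x ∈ spectrum ℝ A, x = a) {i j : Fin n} (hij : i ≠ j) : A i j = 0 := by
  have hsa : IsSelfAdjoint A := hA
  have : A = algebraMap ℝ _ a := by
    calc A = cfc (fun x : ℝ => x) A := (cfc_id' ℝ A).symm
      _ = cfc (fun _ : ℝ => a) A := cfc_congr fun x hx => h x hx
      _ = algebraMap ℝ _ a := cfc_const a A
  rw [this, Matrix.algebraMap_matrix_apply, if_neg hij]

end FunctionalCalculus

/-! ### Chebyshev approximation of the inverse -/

section Chebyshev

open Polynomial

lemma two_mul_eval_T_add_inv {g : ℝ} (hg : 0 < g) (D : ℕ) :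
    (Chebyshev.T ℝ D).eval ((g + g⁻¹) / 2) = (g ^ D + (g ^ D)⁻¹) / 2 := by
  have h := Chebyshev.T_real_cosh (Real.log g) D
  rw [Real.cosh_log hg] at h
  rw [h, Int.cast_natCast, ← Real.log_pow, Real.cosh_log (pow_pos hg D)]

/-- Chebyshev's approximation of `x⁻¹` on `[a, b]` by a polynomial of degree less than `D`: the error
decays like the power `D` of `g = (√(b/a) - 1) / (√(b/a) + 1)`. The defining property of `g` enters
in the form that `(b + a) / (b - a)` is the image of `g` under the Joukowsky map. -/
lemma exists_polynomial_approx_inv {a b g : ℝ} (ha : 0 < a) (hab : a < b) (hg : 0 < g)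
    (hgab : (b + a) / (b - a) = (g + g⁻¹) / 2) (D : ℕ) :
    ∃ p : ℝ[X], (∀ t, D ≤ t → p.coeff t = 0) ∧
      ∀ x, a ≤ x → x ≤ b → |x⁻¹ - p.eval x| ≤ 2 / a * g ^ D := by
  have hba : 0 < b - a := sub_pos.2 hab
  -- The affine function `y` takes `[a, b]` to `[-1, 1]`, and `r` is the normalized Chebyshev polynomial
  -- with `r 0 = 1`, so that `(1 - r) / X` is the approximation.
  set y : ℝ[X] := C (-2 / (b - a)) * X + C ((b + a) / (b - a)) with hy
  set c : ℝ := (g ^ D + (g ^ D)⁻¹) / 2 with hc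
  have hgD : 0 < g ^ D := pow_pos hg D
  have hcpos : 0 < c := by positivity
  set r : ℝ[X] := C c⁻¹ * (Chebyshev.T ℝ D).comp y with hr
  have hr0 : r.coeff 0 = 1 := by
    rw [coeff_zero_eq_eval_zero, hr, eval_mul, eval_comp, hy]
    simp only [eval_C, eval_add, eval_mul, eval_X, mul_zero, zero_add]
    rw [hgab, two_mul_eval_T_add_inv hg]
    exact inv_mul_cancel₀ hcpos.ne'
  have hdeg : r.natDegree ≤ D := by
    refine (natDegree_C_mul_le _ _).trans (natDegree_comp_le.trans ?_)
    have h1 : y.natDegree ≤ 1 := natDegree_linear_le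
    have h2 : (Chebyshev.T ℝ D).natDegree = D := by simp
    rw [h2]
    nlinarith
  refine ⟨-r.divX, fun t ht => ?_, fun x hax hxb => ?_⟩
  · rw [coeff_neg, coeff_divX, coeff_eq_zero_of_natDegree_lt (by omega), neg_zero]
  · have hx : 0 < x := ha.trans_le hax
    have hre : r.eval x = r.divX.eval x * x + 1 := by
      conv_lhs => rw [← divX_mul_X_add r]
      simp [hr0]
    have hdiff : x⁻¹ - (-r.divX).eval x = x⁻¹ * r.eval x := by
      rw [hre, eval_neg]
      field_simp
      ring
    have hyx : |y.eval x| ≤ 1 := by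
      have : y.eval x = (b + a - 2 * x) / (b - a) := by
        simp only [hy, eval_C, eval_add, eval_mul, eval_X]
        ring
      rw [this, abs_div, abs_of_pos hba, div_le_one hba, abs_le]
      constructor <;> linarith
    have hrx : |r.eval x| ≤ 2 * g ^ D := by
      rw [hr, eval_mul, eval_C, eval_comp, abs_mul, abs_of_pos (inv_pos.2 hcpos)]
      have h1 := Chebyshev.abs_eval_T_real_le_one D hyx
      have h2 : c⁻¹ ≤ 2 * g ^ D := by
        rw [inv_le_comm₀ hcpos (by positivity), hc, mul_inv]
        linarith
      calc c⁻¹ * |eval (eval x y) (Chebyshev.T ℝ D)| ≤ c⁻¹ * 1 := by gcongr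
        _ ≤ 2 * g ^ D := by rwa [mul_one]
    rw [hdiff, abs_mul, abs_of_pos (inv_pos.2 hx)]
    calc x⁻¹ * |r.eval x| ≤ a⁻¹ * (2 * g ^ D) := by gcongr
      _ = 2 / a * g ^ D := by ring

end Chebyshev

/-! ### Uncompressed states as inverses of principal submatrices -/

/-- The matrix `F` is the inverse of the principal submatrix of `Q` with index set `S`, extended by
zero to all indices. -/
structure IsPrincipalInverse (Q : Matrix (Fin n) (Fin n) ℝ) (S : Set (Fin n))
    (F : Matrix (Fin n) (Fin n) ℝ) : Prop where
  symm : ∀ i j, F i j = F j i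
  eq_zero : ∀ i j, j ∉ S → F i j = 0
  mul_apply : ∀ i ∈ S, ∀ j ∈ S, (Q * F) i j = if i = j then 1 else 0

/-- The state without the compression, in which no columns are deleted. -/
noncomputable def fullState (Q : Matrix (Fin n) (Fin n) ℝ) (z : Fin n → Bool)
    (ℓ : Fin (n + 1)) : Matrix (Fin n) (Fin n) ℝ :=
  Fin.induction (motive := fun _ => Matrix (Fin n) (Fin n) ℝ) 0
    (fun p W => if z p then W + Matrix.vecMulVec (transitionVec Q p W) (transitionVec Q p W)
      else W) ℓ

/-- The indices chosen by the first `ℓ` assignments of `z`. -/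
def chosen (z : Fin n → Bool) (ℓ : ℕ) : Set (Fin n) := {i | (i : ℕ) < ℓ ∧ z i = true}

lemma le_relevantIndex {Q : Matrix (Fin n) (Fin n) ℝ} {i j : Fin n} (h : Q i j ≠ 0) :
    (j : ℕ) + 1 ≤ relevantIndex Q i := by
  classical
  unfold relevantIndex
  exact Finset.le_sup (f := fun j : Fin n => (j : ℕ) + 1) (by simpa using h)

lemma relevantIndex_le {Q : Matrix (Fin n) (Fin n) ℝ} {k : ℕ} (hQ : HasBandwidth Q k)
    (i : Fin n) : relevantIndex Q i ≤ i + k + 1 := by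
  classical
  unfold relevantIndex
  refine Finset.sup_le fun j hj => ?_
  by_contra hcon
  refine (Finset.mem_filter.1 hj).2 (hQ i j ?_)
  rw [lt_abs]
  right
  omega

lemma transitionVec_congr {Q : Matrix (Fin n) (Fin n) ℝ} {p : Fin n}
    {W F : Matrix (Fin n) (Fin n) ℝ} (h : W.mulVec (Q.col p) = F.mulVec (Q.col p)) :
    transitionVec Q p W = transitionVec Q p F := by
  simp only [transitionVec, h]

/-- The compression does not affect the later transitions: a deleted column `j` has `Q j p = 0` for
every later variable `p`. -/
lemma pathState_apply (Q : Matrix (Fin n) (Fin n) ℝ) (z : Fin n → Bool)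
    (ℓ : Fin (n + 1)) :
    ∀ i j, pathState Q z ℓ i j = if relevantIndex Q j ≤ ℓ then 0 else fullState Q z ℓ i j := by
  induction ℓ using Fin.induction with
  | zero => intro i j; simp [pathState, fullState]
  | succ p ih =>
    intro i j
    have hs : pathState Q z p.succ = transition Q p (pathState Q z p.castSucc) (z p) := by
      simp [pathState, Fin.induction_succ]
    have hf : fullState Q z p.succ = if z p then fullState Q z p.castSucc +
        Matrix.vecMulVec (transitionVec Q p (fullState Q z p.castSucc))
          (transitionVec Q p (fullState Q z p.castSucc)) else fullState Q z p.castSucc := by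
      simp [fullState, Fin.induction_succ]
    have hu : transitionVec Q p (pathState Q z p.castSucc) =
        transitionVec Q p (fullState Q z p.castSucc) := by
      apply transitionVec_congr
      ext r
      simp only [Matrix.mulVec, dotProduct, Matrix.col_apply]
      refine Finset.sum_congr rfl fun s _ => ?_
      rw [ih r s]
      by_cases hsp : Q s p = 0
      · simp [hsp]
      · have := le_relevantIndex hsp
        rw [if_neg]
        simp only [Fin.val_castSucc]
        omega
    rw [hs, hf]
    simp only [transition, Matrix.of_apply, hu, Fin.val_succ]
    split_ifs with h1 h2
    · rfl
    · rw [ih i j, if_neg (by simp only [Fin.val_castSucc]; omega)]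
      simp [Matrix.vecMulVec_apply]
    · rw [ih i j, if_neg (by simp only [Fin.val_castSucc]; omega)]

/-- Bordering: the rank one update of a transition turns the inverse for `S` into the inverse for
`insert p S`. The radicand is the value of the quadratic form of `Q` at the unnormalized transition
vector, hence positive. -/
lemma IsPrincipalInverse.insert {Q : Matrix (Fin n) (Fin n) ℝ} (hQ : Q.PosDef)
    {S : Set (Fin n)} {F : Matrix (Fin n) (Fin n) ℝ} (hF : IsPrincipalInverse Q S F)
    {p : Fin n} (hp : p ∉ S) :
    IsPrincipalInverse Q (insert p S)
      (F + Matrix.vecMulVec (transitionVec Q p F) (transitionVec Q p F)) := by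
  have hsym : ∀ i j, Q i j = Q j i := fun i j => by
    simpa using hQ.isHermitian.apply j i
  have hcol0 : ∀ i j, j ∉ S → (Q * F) i j = 0 := fun i j hj => by
    simp [Matrix.mul_apply, hF.eq_zero _ j hj]
  set q := Q.col p with hq
  set v : Fin n → ℝ := -(F.mulVec q) + Pi.single p 1 with hv
  set s : ℝ := Q p p - q ⬝ᵥ F.mulVec q with hs
  have hFp : F.mulVec q p = 0 := by
    simp [Matrix.mulVec, dotProduct, hF.symm p, hF.eq_zero _ p hp]
  have hvp : v p = 1 := by simp [hv, hFp]
  have hQv : Q.mulVec v = q - Q.mulVec (F.mulVec q) := by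
    rw [hv, Matrix.mulVec_add, Matrix.mulVec_neg, Matrix.mulVec_single_one]
    rw [add_comm, sub_eq_add_neg]
  have hQvS : ∀ i ∈ S, Q.mulVec v i = 0 := fun i hi => by
    rw [hQv, Pi.sub_apply, Matrix.mulVec_mulVec, sub_eq_zero]
    simp only [Matrix.mulVec, dotProduct]
    rw [Finset.sum_eq_single i]
    · rw [hF.mul_apply i hi i hi, if_pos rfl, one_mul]
    · intro j _ hji
      by_cases hj : j ∈ S
      · rw [hF.mul_apply i hi j hj, if_neg hji.symm, zero_mul]
      · rw [hcol0 i j hj, zero_mul]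
    · simp
  have hQvp : Q.mulVec v p = s := by
    rw [hQv, Pi.sub_apply, hs, hq, Matrix.col_apply]
    congr 1
    simp only [Matrix.mulVec, dotProduct, Matrix.col_apply, hsym p]
  have hvS : ∀ i, i ∉ S → i ≠ p → v i = 0 := fun i hi hip => by
    simp [hv, Matrix.mulVec, dotProduct, hF.symm i, hF.eq_zero _ i hi, hip]
  have hspos : 0 < s := by
    have hne : v ≠ 0 := fun h => by simp [h] at hvp
    have h := hQ.dotProduct_mulVec_pos hne
    have h2 : star v ⬝ᵥ Q.mulVec v = s := by
      simp only [dotProduct, Pi.star_apply, star_trivial]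
      rw [Finset.sum_eq_single p]
      · rw [hvp, hQvp, one_mul]
      · intro j _ hjp
        by_cases hj : j ∈ S
        · rw [hQvS j hj, mul_zero]
        · rw [hvS j hj hjp, zero_mul]
      · simp
    rwa [h2] at h
  have hupd : ∀ i j, Matrix.vecMulVec (transitionVec Q p F) (transitionVec Q p F) i j =
      v i * v j / s := fun i j => by
    have hsq : Real.sqrt s ≠ 0 := (Real.sqrt_pos.2 hspos).ne'
    simp only [Matrix.vecMulVec_apply, transitionVec, Pi.smul_apply, smul_eq_mul]
    rw [← hq, ← hv, ← hs]
    field_simp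
    rw [Real.sq_sqrt hspos.le]
    ring
  have hmul : ∀ i j, (Q * (F + Matrix.vecMulVec (transitionVec Q p F) (transitionVec Q p F))) i j =
      (Q * F) i j + Q.mulVec v i * v j / s := fun i j => by
    rw [Matrix.mul_add, Matrix.add_apply]
    congr 1
    simp only [Matrix.mul_apply, hupd, Matrix.mulVec, dotProduct, Finset.sum_mul, Finset.sum_div]
    exact Finset.sum_congr rfl fun l _ => by ring
  refine ⟨fun i j => ?_, fun i j hj => ?_, fun i hi j hj => ?_⟩
  · rw [Matrix.add_apply, Matrix.add_apply, hupd, hupd, hF.symm i j, mul_comm (v i)]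
  · rw [Set.mem_insert_iff, not_or] at hj
    rw [Matrix.add_apply, hupd, hvS j hj.2 hj.1, hF.eq_zero i j hj.2]
    simp
  · rw [hmul]
    rcases Set.mem_insert_iff.1 hi with rfl | hiS
    · rw [hQvp, mul_div_right_comm, div_self hspos.ne', one_mul]
      rcases Set.mem_insert_iff.1 hj with rfl | hjS
      · rw [hcol0 _ _ hp, hvp]
        simp
      · have hij : i ≠ j := fun h => hp (h ▸ hjS)
        rw [if_neg hij]
        have : v j = -(F.mulVec q j) := by simp [hv, hij.symm]
        rw [this, add_neg_eq_zero]
        simp only [Matrix.mul_apply, Matrix.mulVec, dotProduct]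
        exact Finset.sum_congr rfl fun l _ => by
          rw [hF.symm j l, hsym i l, mul_comm]; rfl
    · rw [hQvS i hiS, zero_mul, zero_div, add_zero]
      rcases Set.mem_insert_iff.1 hj with rfl | hjS
      · rw [hcol0 _ _ hp, if_neg]
        rintro rfl
        exact hp hiS
      · exact hF.mul_apply i hiS j hjS

lemma isPrincipalInverse_fullState {Q : Matrix (Fin n) (Fin n) ℝ} (hQ : Q.PosDef)
    (z : Fin n → Bool) (ℓ : Fin (n + 1)) :
    IsPrincipalInverse Q (chosen z ℓ) (fullState Q z ℓ) := by
  induction ℓ using Fin.induction with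
  | zero => exact ⟨by simp [fullState], by simp [fullState], by simp [chosen]⟩
  | succ p ih =>
    have hf : fullState Q z p.succ = if z p then fullState Q z p.castSucc +
        Matrix.vecMulVec (transitionVec Q p (fullState Q z p.castSucc))
          (transitionVec Q p (fullState Q z p.castSucc)) else fullState Q z p.castSucc := by
      simp [fullState, Fin.induction_succ]
    rw [hf]
    by_cases hz : z p = true
    · have hset : chosen z p.succ = insert p (chosen z p.castSucc) := by
        ext i
        simp only [chosen, Fin.val_succ, Fin.val_castSucc, Set.mem_ofPred_eq, Set.mem_insert_iff,
          Fin.ext_iff, Order.lt_add_one_iff, le_iff_eq_or_lt]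
        constructor
        · rintro ⟨h | h, h'⟩
          · exact Or.inl h
          · exact Or.inr ⟨h, h'⟩
        · rintro (h | h)
          · exact ⟨Or.inl h, by rwa [Fin.ext h]⟩
          · exact ⟨Or.inr h.1, h.2⟩
      rw [if_pos hz, hset]
      exact ih.insert hQ (by simp [chosen])
    · have hset : chosen z p.succ = chosen z p.castSucc := by
        ext i
        simp only [chosen, Fin.val_succ, Fin.val_castSucc, Set.mem_ofPred_eq, and_congr_left_iff]
        intro hi
        have : i ≠ p := by rintro rfl; exact hz hi
        have := Fin.val_ne_of_ne this
        omega
      rw [if_neg hz, hset]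
      exact ih

/-! ### Padded principal submatrices -/

open Classical in
/-- The principal submatrix of `Q` with index set `S`, completed to a matrix on all indices by the
diagonal entry `a` outside of `S`. -/
noncomputable def paddedSubmatrix (Q : Matrix (Fin n) (Fin n) ℝ) (a : ℝ) (S : Set (Fin n)) :
    Matrix (Fin n) (Fin n) ℝ :=
  Matrix.of fun i j => if i ∈ S ∧ j ∈ S then Q i j else if i = j then a else 0

lemma isHermitian_paddedSubmatrix {Q : Matrix (Fin n) (Fin n) ℝ} (hQ : Q.IsHermitian) (a : ℝ)
    (S : Set (Fin n)) : (paddedSubmatrix Q a S).IsHermitian := by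
  refine Matrix.IsHermitian.ext fun i j => ?_
  have : Q j i = Q i j := by simpa using hQ.apply i j
  simp only [paddedSubmatrix, Matrix.of_apply, star_trivial, this]
  by_cases hi : i ∈ S <;> by_cases hj : j ∈ S <;> by_cases hij : i = j <;> simp_all [eq_comm]

open Classical in
/-- Padding keeps the spectrum in `[a, b]`, by compression of quadratic forms. -/
lemma spectrum_paddedSubmatrix {Q : Matrix (Fin n) (Fin n) ℝ} (hQ : Q.IsHermitian) {a b : ℝ}
    (hab : a ≤ b) (ha : ∀ x ∈ spectrum ℝ Q, a ≤ x) (hb : ∀ x ∈ spectrum ℝ Q, x ≤ b)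
    (S : Set (Fin n)) : ∀ x ∈ spectrum ℝ (paddedSubmatrix Q a S), a ≤ x ∧ x ≤ b := by
  have hA := isHermitian_paddedSubmatrix hQ a S
  rw [forall_le_spectrum_iff hQ] at ha
  rw [forall_spectrum_le_iff hQ] at hb
  set E : Matrix (Fin n) (Fin n) ℝ := Matrix.diagonal fun i => if i ∈ S then 1 else 0 with hE
  set G : Matrix (Fin n) (Fin n) ℝ := Matrix.diagonal fun i => if i ∈ S then 0 else b - a with hG
  have h1 : paddedSubmatrix Q a S - algebraMap ℝ _ a =
      E * (Q - algebraMap ℝ _ a) * E.conjTranspose := by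
    ext i j
    simp only [hE, Matrix.diagonal_conjTranspose, Matrix.mul_diagonal, Matrix.diagonal_mul,
      Matrix.sub_apply, Matrix.algebraMap_matrix_apply, paddedSubmatrix, Matrix.of_apply,
      star_trivial]
    by_cases hi : i ∈ S <;> by_cases hj : j ∈ S <;> by_cases hij : i = j <;> simp_all
  have h2 : algebraMap ℝ _ b - paddedSubmatrix Q a S =
      E * (algebraMap ℝ _ b - Q) * E.conjTranspose + G := by
    ext i j
    simp only [hE, hG, Matrix.diagonal_conjTranspose, Matrix.mul_diagonal, Matrix.diagonal_mul,
      Matrix.sub_apply, Matrix.add_apply, Matrix.algebraMap_matrix_apply, paddedSubmatrix,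
      Matrix.of_apply, star_trivial, Matrix.diagonal_apply]
    by_cases hi : i ∈ S <;> by_cases hj : j ∈ S <;> by_cases hij : i = j <;> simp_all
  have hGpos : G.PosSemidef := Matrix.PosSemidef.diagonal fun i => by
    simp only [Pi.zero_apply]
    split_ifs
    exacts [le_rfl, sub_nonneg.2 hab]
  have hlow := (forall_le_spectrum_iff hA a).2 (h1 ▸ ha.mul_mul_conjTranspose_same E)
  have hup := (forall_spectrum_le_iff hA b).2
    (h2 ▸ (hb.mul_mul_conjTranspose_same E).add hGpos)
  exact fun x hx => ⟨hlow x hx, hup x hx⟩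

open Classical in
lemma IsPrincipalInverse.paddedSubmatrix_mul {Q : Matrix (Fin n) (Fin n) ℝ} {S : Set (Fin n)}
    {F : Matrix (Fin n) (Fin n) ℝ} (hF : IsPrincipalInverse Q S F) {a : ℝ} (ha : a ≠ 0) :
    paddedSubmatrix Q a S * (F + Matrix.diagonal fun i => if i ∈ S then 0 else a⁻¹) = 1 := by
  ext i j
  rw [Matrix.mul_add, Matrix.add_apply, Matrix.mul_diagonal, Matrix.mul_apply, Matrix.one_apply]
  by_cases hi : i ∈ S
  · have h1 : ∑ l, paddedSubmatrix Q a S i l * F l j = (Q * F) i j := by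
      rw [Matrix.mul_apply]
      refine Finset.sum_congr rfl fun l _ => ?_
      by_cases hl : l ∈ S
      · simp [paddedSubmatrix, hi, hl]
      · rw [hF.symm l j, hF.eq_zero j l hl, mul_zero, mul_zero]
    rw [h1]
    by_cases hj : j ∈ S
    · simp [hj, hF.mul_apply i hi j hj]
    · have hij : i ≠ j := fun h => hj (h ▸ hi)
      have h2 : (Q * F) i j = 0 := by simp [Matrix.mul_apply, hF.eq_zero _ j hj]
      simp [hj, hij, h2, paddedSubmatrix]
  · have h1 : ∑ l, paddedSubmatrix Q a S i l * F l j = 0 := by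
      refine Finset.sum_eq_zero fun l _ => ?_
      by_cases hil : i = l
      · subst hil
        rw [hF.symm i j, hF.eq_zero j i hi, mul_zero]
      · simp [paddedSubmatrix, hi, hil]
    rw [h1, zero_add]
    by_cases hij : i = j
    · subst hij
      simp [paddedSubmatrix, hi, ha]
    · simp [paddedSubmatrix, hi, hij]

/-- The column `j` of the power `t` of a padded submatrix of a matrix with bandwidth `k` depends only
on the part of the index set from `j - k * t` on, and it vanishes above row `j - k * t`. -/
lemma pow_paddedSubmatrix_congr {Q : Matrix (Fin n) (Fin n) ℝ} {k : ℕ} (hQ : HasBandwidth Q k)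
    (a : ℝ) {S S' : Set (Fin n)} {c : ℕ} (hS : ∀ i : Fin n, c ≤ i → (i ∈ S ↔ i ∈ S'))
    (j : Fin n) (t : ℕ) (ht : c + k * t ≤ j) :
    (∀ i, (paddedSubmatrix Q a S ^ t) i j = (paddedSubmatrix Q a S' ^ t) i j) ∧
      ∀ i : Fin n, (i : ℕ) + k * t < j → (paddedSubmatrix Q a S ^ t) i j = 0 := by
  induction t with
  | zero =>
    refine ⟨fun i => by simp, fun i hi => ?_⟩
    rw [pow_zero, Matrix.one_apply_ne]
    rintro rfl
    simp at hi
  | succ t ih =>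
    rw [mul_add, mul_one] at ht
    obtain ⟨ih1, ih2⟩ := ih (by omega)
    -- Row `i` of a padded submatrix sees no index after `i + k`.
    have hfar : ∀ (T : Set (Fin n)) (i l : Fin n), (i : ℕ) + k < l →
        paddedSubmatrix Q a T i l = 0 := fun T i l hil => by
      have hne : i ≠ l := by rintro rfl; omega
      have hz : Q i l = 0 := hQ i l (by rw [lt_abs]; right; omega)
      simp [paddedSubmatrix, hne, hz]
    have hsupp : ∀ (T : Set (Fin n)) (i l : Fin n), (i : ℕ) + (k * t + k) < j →
        paddedSubmatrix Q a T i l * (paddedSubmatrix Q a S ^ t) l j = 0 := fun T i l hi => by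
      by_cases hl : (l : ℕ) + k * t < j
      · rw [ih2 l hl, mul_zero]
      · rw [hfar T i l (by omega), zero_mul]
    refine ⟨fun i => ?_, fun i hi => ?_⟩
    · rw [pow_succ', pow_succ', Matrix.mul_apply, Matrix.mul_apply]
      refine Finset.sum_congr rfl fun l _ => ?_
      rw [← ih1 l]
      by_cases hi : (i : ℕ) + (k * t + k) < j
      · rw [hsupp S i l hi, hsupp S' i l hi]
      · by_cases hl : (l : ℕ) + k * t < j
        · rw [ih2 l hl, mul_zero, mul_zero]
        · have hiS := hS i (by omega)
          have hlS := hS l (by omega)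
          congr 1
          classical exact if_congr (and_congr hiS hlS) rfl rfl
    · rw [pow_succ', Matrix.mul_apply]
      exact Finset.sum_eq_zero fun l _ => hsupp S i l (by rw [mul_add, mul_one] at hi; exact hi)

/-! ### Distance of states that share their last assignments -/

section Distance

open Polynomial

open Classical in
/-- Polynomial approximation of the columns of an inverse principal submatrix. -/
lemma IsPrincipalInverse.abs_sub_aeval_le {Q : Matrix (Fin n) (Fin n) ℝ} (hQ : Q.IsHermitian)
    {S : Set (Fin n)} {F : Matrix (Fin n) (Fin n) ℝ} (hF : IsPrincipalInverse Q S F) {a b M : ℝ}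
    (ha0 : 0 < a) (hab : a ≤ b) (ha : ∀ x ∈ spectrum ℝ Q, a ≤ x) (hb : ∀ x ∈ spectrum ℝ Q, x ≤ b)
    (hM : 0 ≤ M) {p : ℝ[X]} (hp : ∀ x, a ≤ x → x ≤ b → |x⁻¹ - p.eval x| ≤ M) (i j : Fin n) :
    |F i j - if j ∈ S then aeval (paddedSubmatrix Q a S) p i j else 0| ≤ M := by
  by_cases hj : j ∈ S
  · have hspec := spectrum_paddedSubmatrix hQ hab ha hb S
    have h := abs_inv_sub_aeval_entry_le (isHermitian_paddedSubmatrix hQ a S)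
      (hF.paddedSubmatrix_mul ha0.ne') hM (fun x hx => (ha0.trans_le (hspec x hx).1).ne')
      (fun x hx => hp x (hspec x hx).1 (hspec x hx).2) i j
    have hd : (Matrix.diagonal fun i => if i ∈ S then 0 else a⁻¹) i j = 0 := by
      rw [Matrix.diagonal_apply]
      split_ifs with h1 h2
      · rfl
      · exact absurd (h1 ▸ hj) h2
      · rfl
    rw [Matrix.add_apply, hd, add_zero] at h
    rwa [if_pos hj]
  · rw [if_neg hj, hF.eq_zero i j hj]
    simpa using hM

/-- Both columns are approximated by the same polynomial of degree less than `m / k` in the padded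
submatrices, and the powers that occur do not see the indices where the two choices differ. -/
lemma abs_fullState_sub_le {Q : Matrix (Fin n) (Fin n) ℝ} (hQ : Q.PosDef) {k : ℕ} (hk : 0 < k)
    (hband : HasBandwidth Q k) {a b g : ℝ} (ha0 : 0 < a) (hab : a < b)
    (ha : ∀ x ∈ spectrum ℝ Q, a ≤ x) (hb : ∀ x ∈ spectrum ℝ Q, x ≤ b) (hg : 0 < g)
    (hgab : (b + a) / (b - a) = (g + g⁻¹) / 2) {m : ℕ} {ℓ : Fin (n + 1)} {z z' : Fin n → Bool}
    (hz : ∀ i : Fin n, (i : ℕ) < ℓ → (ℓ : ℕ) ≤ i + m → z i = z' i)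
    (i j : Fin n) (hj : (ℓ : ℕ) ≤ j + k) :
    |fullState Q z ℓ i j - fullState Q z' ℓ i j| ≤ 4 / a * g ^ (m / k) := by
  classical
  obtain ⟨p, hpc, hp⟩ := exists_polynomial_approx_inv ha0 hab hg hgab (m / k)
  have hM : 0 ≤ 2 / a * g ^ (m / k) := by positivity
  have h1 := (isPrincipalInverse_fullState hQ z ℓ).abs_sub_aeval_le hQ.isHermitian ha0 hab.le ha hb
    hM hp i j
  have h2 := (isPrincipalInverse_fullState hQ z' ℓ).abs_sub_aeval_le hQ.isHermitian ha0 hab.le ha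
    hb hM hp i j
  have hS : ∀ i : Fin n, (ℓ : ℕ) - m ≤ i → (i ∈ chosen z ℓ ↔ i ∈ chosen z' ℓ) := fun i hi =>
    and_congr_right fun hil => by rw [hz i hil (by omega)]
  have heq : (if j ∈ chosen z ℓ then aeval (paddedSubmatrix Q a (chosen z ℓ)) p i j else 0) =
      if j ∈ chosen z' ℓ then aeval (paddedSubmatrix Q a (chosen z' ℓ)) p i j else 0 := by
    rcases Nat.eq_zero_or_pos (m / k) with hD | hD
    · have hp0 : p = 0 := Polynomial.ext fun t => by rw [hpc t (by omega), coeff_zero]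
      simp [hp0]
    · have hkm : k ≤ m := (Nat.div_pos_iff.1 hD).2
      have haeval : aeval (paddedSubmatrix Q a (chosen z ℓ)) p i j =
          aeval (paddedSubmatrix Q a (chosen z' ℓ)) p i j := by
        simp only [aeval_eq_sum_range, Matrix.sum_apply, Matrix.smul_apply]
        refine Finset.sum_congr rfl fun t _ => ?_
        by_cases ht : t < m / k
        · have htm := (Nat.le_div_iff_mul_le hk).1 (Nat.succ_le_of_lt ht)
          rw [Nat.succ_mul, mul_comm t] at htm
          -- The truncated subtraction `ℓ - m` vanishes if all assignments agree.
          rcases Nat.lt_or_ge ℓ m with hlm | hlm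
          · have hset : chosen z ℓ = chosen z' ℓ := Set.ext fun i => hS i (by omega)
            rw [hset]
          · rw [(pow_paddedSubmatrix_congr hband a hS j t (by omega)).1 i]
        · rw [hpc t (by omega), zero_smul, zero_smul]
      rw [haeval]
      simp only [hS j (by omega)]
  rw [heq] at h1
  rw [abs_sub_comm] at h2
  calc |fullState Q z ℓ i j - fullState Q z' ℓ i j| ≤ _ + _ := abs_sub_le _ _ _
    _ ≤ 2 / a * g ^ (m / k) + 2 / a * g ^ (m / k) := add_le_add h1 h2
    _ = 4 / a * g ^ (m / k) := by ring

/-- For a diagonal matrix the only column that is compared is the one of the next variable, which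
is zero in every state. -/
lemma indistinguishable_of_hasBandwidth_zero {Q : Matrix (Fin n) (Fin n) ℝ} (hQ : Q.PosDef)
    (hband : HasBandwidth Q 0) {ε : ℝ} (hε : 0 ≤ ε) (ℓ : Fin (n + 1)) (z z' : Fin n → Bool) :
    Indistinguishable Q ε ℓ (pathState Q z ℓ) (pathState Q z' ℓ) := by
  intro j hjl hlj
  have hle := relevantIndex_le hband j
  have h0 : ∀ y : Fin n → Bool, (pathState Q y ℓ).col j = 0 := fun y => by
    ext i
    rw [Matrix.col_apply, pathState_apply, if_neg (by omega),
      (isPrincipalInverse_fullState hQ y ℓ).eq_zero i j]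
    · rfl
    · rintro ⟨h, -⟩
      omega
  rw [h0, h0, sub_zero, norm_zero]
  exact hε

end Distance

/-! ### Eigenvalue bounds and the decay rate -/

section Rate

lemma minEig_le {Q : Matrix (Fin n) (Fin n) ℝ} {x : ℝ} (hx : x ∈ spectrum ℝ Q) : minEig Q ≤ x :=
  csInf_le Q.finite_real_spectrum.bddBelow hx

lemma le_maxEig {Q : Matrix (Fin n) (Fin n) ℝ} {x : ℝ} (hx : x ∈ spectrum ℝ Q) : x ≤ maxEig Q :=
  le_csSup Q.finite_real_spectrum.bddAbove hx

lemma minEig_mem_spectrum {Q : Matrix (Fin n) (Fin n) ℝ} (hn : 0 < n) (hQ : Q.IsHermitian) :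
    minEig Q ∈ spectrum ℝ Q :=
  Set.Nonempty.csInf_mem ⟨_, hQ.eigenvalues_mem_spectrum_real ⟨0, hn⟩⟩ Q.finite_real_spectrum

lemma minEig_pos {Q : Matrix (Fin n) (Fin n) ℝ} (hn : 0 < n) (hQ : Q.PosDef) : 0 < minEig Q := by
  have h := minEig_mem_spectrum hn hQ.isHermitian
  rw [hQ.isHermitian.spectrum_real_eq_range_eigenvalues] at h
  obtain ⟨i, hi⟩ := h
  exact hi ▸ hQ.eigenvalues_pos i

lemma minEig_le_maxEig {Q : Matrix (Fin n) (Fin n) ℝ} (hn : 0 < n) (hQ : Q.IsHermitian) :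
    minEig Q ≤ maxEig Q :=
  le_maxEig (minEig_mem_spectrum hn hQ)

lemma decayRate_spec {Q : Matrix (Fin n) (Fin n) ℝ} (h0 : 0 < minEig Q)
    (hlt : minEig Q < maxEig Q) :
    0 < decayRate Q ∧ decayRate Q < 1 ∧ (maxEig Q + minEig Q) / (maxEig Q - minEig Q) =
      (decayRate Q + (decayRate Q)⁻¹) / 2 := by
  have hc : 1 < condNumber Q := (one_lt_div h0).2 hlt
  have hs : 1 < Real.sqrt (condNumber Q) := by
    rwa [Real.lt_sqrt (by norm_num), one_pow]
  have hsq : Real.sqrt (condNumber Q) ^ 2 = condNumber Q := Real.sq_sqrt (by linarith)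
  have hmax : maxEig Q = Real.sqrt (condNumber Q) ^ 2 * minEig Q := by
    rw [hsq, condNumber, div_mul_cancel₀ _ h0.ne']
  unfold decayRate
  rw [hmax]
  set s := Real.sqrt (condNumber Q)
  have h1 : 0 < s - 1 := by linarith
  have h2 : 0 < s + 1 := by linarith
  refine ⟨div_pos h1 h2, (div_lt_one h2).2 (by linarith), ?_⟩
  have h3 : s ^ 2 * minEig Q - minEig Q ≠ 0 := by
    have : s ^ 2 * minEig Q - minEig Q = (s - 1) * (s + 1) * minEig Q := by ring
    rw [this]
    positivity
  rw [inv_div, div_add_div _ _ h2.ne' h1.ne', div_div,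
    div_eq_div_iff h3 (by positivity)]
  ring

/-- The condition on `m` makes the power `m / k` of the rate beat `ε / K`. -/
lemma mul_pow_div_le {k m : ℕ} (hk : 0 < k) {K ε g : ℝ} (hK : 0 < K) (hε : 0 < ε) (hg : 0 < g)
    (hg1 : g < 1) (hm : (k : ℝ) - 1 + k * (Real.log (K / ε) / |Real.log g|) ≤ m) :
    K * g ^ (m / k) ≤ ε := by
  have hk' : (0 : ℝ) < k := Nat.cast_pos.2 hk
  have hlog : Real.log g < 0 := Real.log_neg hg hg1
  have hmD : m + 1 ≤ k * (m / k + 1) := Nat.lt_mul_div_succ m hk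
  have hmD' : (m : ℝ) + 1 ≤ k * ((m / k : ℕ) + 1) := by exact_mod_cast hmD
  have h1 : Real.log (K / ε) / |Real.log g| ≤ (m / k : ℕ) :=
    le_of_mul_le_mul_left (by linarith) hk'
  rw [abs_of_neg hlog, div_le_iff₀ (neg_pos.2 hlog)] at h1
  have h2 : Real.log (K / ε * g ^ (m / k)) ≤ 0 := by
    rw [Real.log_mul (by positivity) (by positivity), Real.log_pow]
    linarith
  have h3 : K / ε * g ^ (m / k) ≤ 1 := by
    rw [← Real.log_nonpos_iff (by positivity)]
    exact h2
  rwa [div_mul_eq_mul_div, div_le_one hε] at h3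

end Rate

/-! ### Indistinguishable paths and the size of a merged layer -/

section Merging

lemma indistinguishable_pathState {Q : Matrix (Fin n) (Fin n) ℝ} (hn : 0 < n) (hQ : Q.PosDef)
    {k : ℕ} (hband : HasBandwidth Q k) {ε : ℝ} (hε : 0 < ε) {m : ℕ}
    (hm : (k : ℝ) - 1 + k * (Real.log (4 / minEig Q / ε) / |Real.log (decayRate Q)|) ≤ m)
    {ℓ : Fin (n + 1)} {z z' : Fin n → Bool}
    (hz : ∀ i : Fin n, (i : ℕ) < ℓ → (ℓ : ℕ) ≤ i + m → z i = z' i) :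
    Indistinguishable Q ε ℓ (pathState Q z ℓ) (pathState Q z' ℓ) := by
  have h0 := minEig_pos hn hQ
  rcases (minEig_le_maxEig hn hQ.isHermitian).eq_or_lt with heq | hlt
  · refine indistinguishable_of_hasBandwidth_zero hQ (fun i j hij => ?_) hε.le ℓ z z'
    refine apply_eq_zero_of_spectrum_eq hQ.isHermitian (a := minEig Q)
      (fun x hx => le_antisymm (heq ▸ le_maxEig hx) (minEig_le hx)) ?_
    rintro rfl
    simp at hij
  rcases Nat.eq_zero_or_pos k with rfl | hk
  · exact indistinguishable_of_hasBandwidth_zero hQ hband hε.le ℓ z z'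
  obtain ⟨hg, hg1, hgab⟩ := decayRate_spec h0 hlt
  intro j _ hlj
  rw [pi_norm_le_iff_of_nonneg hε.le]
  intro i
  have hle := relevantIndex_le hband j
  rw [Pi.sub_apply, Matrix.col_apply, Matrix.col_apply, pathState_apply, pathState_apply,
    if_neg (by omega), if_neg (by omega), Real.norm_eq_abs]
  exact (abs_fullState_sub_le hQ hk hband h0 hlt (fun x hx => minEig_le hx)
    (fun x hx => le_maxEig hx) hg hgab hz i j (by omega)).trans
    (mul_pow_div_le hk (by positivity) hε hg hg1 hm)

lemma IsCompleteMerging.subset_layer {Q : Matrix (Fin n) (Fin n) ℝ} {ε : ℝ} {ℓ : Fin (n + 1)}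
    {R : Set (Matrix (Fin n) (Fin n) ℝ)} (hR : IsCompleteMerging Q ε ℓ R) : R ⊆ layer Q ℓ := by
  have key : ∀ N, Relation.ReflTransGen (MergeStep Q ε ℓ) (layer Q ℓ) N → N ⊆ layer Q ℓ := by
    intro N hN
    induction hN with
    | refl => exact subset_rfl
    | tail _ hstep ih =>
      obtain ⟨s, _, t, _, _, _, rfl⟩ := hstep
      exact Set.sdiff_subset.trans ih
  exact key R hR.1

/-- If agreement on the last `m` assignments forces indistinguishability, then the nodes that remain
after complete merging are determined by the last `m` assignments. -/
lemma IsCompleteMerging.ncard_le {Q : Matrix (Fin n) (Fin n) ℝ} {ε : ℝ} {ℓ : Fin (n + 1)}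
    {R : Set (Matrix (Fin n) (Fin n) ℝ)} (hR : IsCompleteMerging Q ε ℓ R) {m : ℕ}
    (h : ∀ z z' : Fin n → Bool,
      (∀ i : Fin n, (i : ℕ) < ℓ → (ℓ : ℕ) ≤ i + m → z i = z' i) →
      Indistinguishable Q ε ℓ (pathState Q z ℓ) (pathState Q z' ℓ)) :
    R.ncard ≤ 2 ^ m := by
  have hpath : ∀ s ∈ R, ∃ z : Fin n → Bool, pathState Q z ℓ = s := fun s hs => hR.subset_layer hs
  choose! w hw using hpath
  -- Position `t` of the code holds the assignment of the variable `t + 1` places before the layer.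
  let code : Matrix (Fin n) (Fin n) ℝ → Fin m → Bool := fun s t =>
    if ht : (ℓ : ℕ) - 1 - t < n then w s ⟨ℓ - 1 - t, ht⟩ else false
  have hinj : Set.InjOn code R := by
    intro s hs t ht hst
    refine hR.2 s hs t ht ?_
    rw [← hw s hs, ← hw t ht]
    refine h _ _ fun i hil hli => ?_
    have hcode := congrFun hst ⟨(ℓ : ℕ) - 1 - i, by omega⟩
    have hidx : (ℓ : ℕ) - 1 - ((ℓ : ℕ) - 1 - i) = i := by omega
    simpa only [code, hidx, i.isLt, dif_pos, Fin.eta] using hcode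
  calc R.ncard ≤ (Set.univ : Set (Fin m → Bool)).ncard :=
        Set.ncard_le_ncard_of_injOn code (fun _ _ => Set.mem_univ _) hinj
    _ = 2 ^ m := by simp [Set.ncard_univ]

/-- Rounding the threshold of the path lemma up costs the factor `2 ^ k`; the rest is `log 2 ≤ 1`. -/
lemma two_pow_ceil_le (k : ℕ) {x c : ℝ} (hx : 1 ≤ x) (hc : 0 ≤ c) :
    (2 : ℝ) ^ ⌈(k : ℝ) - 1 + k * (Real.log x / c)⌉₊ ≤ 2 ^ k * x ^ ((k : ℝ) / c) := by
  have hlog : 0 ≤ Real.log x := Real.log_nonneg hx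
  have hy : 0 ≤ (k : ℝ) * (Real.log x / c) := by positivity
  have hceil : (⌈(k : ℝ) - 1 + k * (Real.log x / c)⌉₊ : ℝ) ≤ k + k * (Real.log x / c) := by
    rcases Nat.eq_zero_or_pos k with rfl | hk
    · have : ⌈((0 : ℕ) : ℝ) - 1 + ((0 : ℕ) : ℝ) * (Real.log x / c)⌉₊ = 0 :=
        Nat.ceil_eq_zero.2 (by norm_num)
      rw [this]
      simp
    · have hk' : (1 : ℝ) ≤ k := by exact_mod_cast hk
      have := Nat.ceil_lt_add_one (a := (k : ℝ) - 1 + k * (Real.log x / c)) (by linarith)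
      linarith
  have hx0 : 0 < x := by linarith
  calc (2 : ℝ) ^ ⌈(k : ℝ) - 1 + k * (Real.log x / c)⌉₊
      = (2 : ℝ) ^ (⌈(k : ℝ) - 1 + k * (Real.log x / c)⌉₊ : ℝ) := (Real.rpow_natCast _ _).symm
    _ ≤ (2 : ℝ) ^ ((k : ℝ) + k * (Real.log x / c)) :=
        Real.rpow_le_rpow_of_exponent_le (by norm_num) hceil
    _ = 2 ^ k * (2 : ℝ) ^ ((k : ℝ) * (Real.log x / c)) := by
        rw [Real.rpow_add (by norm_num), Real.rpow_natCast]
    _ ≤ 2 ^ k * x ^ ((k : ℝ) / c) := by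
        gcongr
        rw [Real.rpow_def_of_pos (by norm_num), Real.rpow_def_of_pos hx0, Real.exp_le_exp]
        have h2 : Real.log 2 ≤ 1 := by linarith [Real.log_two_lt_d9]
        calc Real.log 2 * ((k : ℝ) * (Real.log x / c)) ≤ 1 * ((k : ℝ) * (Real.log x / c)) := by
              gcongr
          _ = Real.log x * (k / c) := by ring

end Merging

end BandedDD

theorem mainTheorem8 (k : ℕ) (lmin lmax : ℝ) :
    ∃ K : ℝ, 0 < K ∧
      ∀ (n : ℕ), 0 < n → ∀ (Q : Matrix (Fin n) (Fin n) ℝ), Q.PosDef →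
        BandedDD.HasBandwidth Q k → BandedDD.minEig Q = lmin → BandedDD.maxEig Q = lmax →
        ∀ (ε : ℝ), 0 < ε → ∀ (ℓ : Fin (n + 1)),
          (∀ (m : ℕ),
            (k : ℝ) - 1 + k * (Real.log (K / ε) / |Real.log (BandedDD.decayRate Q)|) ≤ m →
            ∀ (z z' : Fin n → Bool),
              (∀ i : Fin n, (i : ℕ) + m < ℓ → z' i = false) →
              (∀ i : Fin n, (i : ℕ) < ℓ → (ℓ : ℕ) ≤ i + m → z i = z' i) →
              BandedDD.Indistinguishable Q ε ℓ
                (BandedDD.pathState Q z ℓ) (BandedDD.pathState Q z' ℓ)) ∧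
          (∀ R : Set (Matrix (Fin n) (Fin n) ℝ), BandedDD.IsCompleteMerging Q ε ℓ R →
            R.Finite ∧
              (R.ncard : ℝ) ≤
                2 ^ k * (max 1 (K / ε)) ^ ((k : ℝ) / |Real.log (BandedDD.decayRate Q)|)) := by
  -- If `lmin` is not positive, no matrix satisfies the hypotheses.
  rcases le_or_gt lmin 0 with hl | hl
  · refine ⟨1, one_pos, fun n hn Q hQ _ hmin => ?_⟩
    exact absurd (BandedDD.minEig_pos hn hQ) (by rw [hmin]; exact not_lt.2 hl)
  refine ⟨4 / lmin, by positivity, fun n hn Q hQ hband hmin _ ε hε ℓ => ⟨?_, fun R hR => ⟨?_, ?_⟩⟩⟩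
  · intro m hm z z' _ hz
    rw [← hmin] at hm
    exact BandedDD.indistinguishable_pathState hn hQ hband hε hm hz
  · exact (Set.finite_range _).subset hR.subset_layer
  · set c := |Real.log (BandedDD.decayRate Q)| with hc
    set m := ⌈(k : ℝ) - 1 + k * (Real.log (max 1 (4 / lmin / ε)) / c)⌉₊ with hm
    have hlog : Real.log (4 / lmin / ε) ≤ Real.log (max 1 (4 / lmin / ε)) :=
      Real.log_le_log (by positivity) (le_max_right _ _)
    have hthr : (k : ℝ) - 1 + k * (Real.log (4 / BandedDD.minEig Q / ε) / c) ≤ m := by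
      rw [hmin]
      refine le_trans ?_ (Nat.le_ceil _)
      gcongr
    have hcard := hR.ncard_le (m := m) fun z z' hz =>
      BandedDD.indistinguishable_pathState hn hQ hband hε hthr hz
    calc (R.ncard : ℝ) ≤ 2 ^ m := by exact_mod_cast hcard
      _ ≤ _ := BandedDD.two_pow_ceil_le k (le_max_left _ _) (abs_nonneg _)
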